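/- Let $K$ be a global field, i.e. an algebraic number field or an algebraic function field in one variable with finite constant field. Let $S$ be a finite set of primes of $K$ which contains all archimedean primes if $K$ is a number field and is nonempty if $K$ is a function field, and let $$A=\{a\in K : \mathrm{ord}_P(a)\ge 0 \text{ for all primes } P\notin S\}$$ be the ring of $S$-integers of $K$. For a prime ideal $P\neq 0$ of $A$ and a positive integer $k$, an element $a\in A$ is a $k$th power residue modulo $P$ if $a\notin P$ and $a\equiv x^k \pmod P$ for some $x\in A$. A sequence $r_1,\dots,r_m$ in $A$ is a permutation chain of $k$th power residues modulo $P$ if for every permutation $\sigma\in S_m$ the $m(m+1)/2$ sums $\sum_{l=i}^{j} r_{\sigma(l)}$ $(1\le i\le j\le m)$ are $k$th power residues modulo $P$ and are pairwise incongruent modulo $P$. Let $k$ and $m$ be arbitrary positive integers. Then there is a sequence $r_1,\dots,r_m$ in $A$ which is a permutation chain of $k$th power residues modulo $P$ for infinitely many nonzero prime ideals $P$ of $A$. More precisely: - if $K$ is a number field and $p$ is a prime number lying below some prime ideal of $A$, then $1,p,\dots,p^{m-1}$ is such a sequence; - if $K$ is a function field and $t\in A$ is transcendental over the constant field of $K$,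 then $1,t,\dots,t^{m-1}$ is such a sequence. -/

import Mathlib

/-- The constant field of `K`: the elements of `K` that are algebraic over its prime field. For a
function field over a finite field `F` this is the algebraic closure of `F` in `K`. -/
def constantField (K : Type*) [Field K] : Subfield K :=
  (algebraicClosure (⊥ : Subfield K) K).toSubfield

/-- `K` is an algebraic function field (in one variable) with finite constant field: it is a
finite extension of the rational function field `F(X)` over some finite field `F`. -/
def IsGlobalFunctionField (K : Type*) [Field K] : Prop :=
  ∃ (F : Type) (_ : Field F) (_ : Finite F) (_ : Algebra (RatFunc F) K), FunctionField F K

/-- A global field: an algebraic number field or an algebraic function field with finite constant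
field. -/
def IsGlobalField (K : Type*) [Field K] : Prop :=
  NumberField K ∨ IsGlobalFunctionField K

/-- A nonarchimedean prime of `K`: a discrete valuation ring whose field of fractions is `K`.
For the normalized valuation `ord_P` of such a prime `P`, `ord_P a ≥ 0` says `a ∈ P`. -/
def FinitePrime (K : Type*) [Field K] : Type _ :=
  {V : ValuationSubring K // IsDiscreteValuationRing V}

/-- The ring of `S`-integers of `K`: the elements `a` with `ord_P a ≥ 0` for every nonarchimedean
prime `P` outside `S`. In a number field, the archimedean primes always belong to the excluded
set, so `S` only lists its nonarchimedean members. -/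
def SIntegerRing {K : Type*} [Field K] (S : Finset (FinitePrime K)) : Subring K where
  carrier := {a | ∀ P : FinitePrime K, P ∉ S → a ∈ P.1}
  zero_mem' := fun P _ => P.1.zero_mem
  one_mem' := fun P _ => P.1.one_mem
  add_mem' := fun ha hb P hP => P.1.add_mem _ _ (ha P hP) (hb P hP)
  mul_mem' := fun ha hb P hP => P.1.mul_mem _ _ (ha P hP) (hb P hP)
  neg_mem' := fun ha P hP => P.1.neg_mem _ (ha P hP)

/-- `a` is a `k`th power residue modulo `P`: it is nonzero modulo `P` and congruent modulo `P` to
a `k`th power. -/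
def IsPowerResidue {A : Type*} [CommRing A] (k : ℕ) (P : Ideal A) (a : A) : Prop :=
  a ∉ P ∧ ∃ x : A, x ^ k - a ∈ P

/-- The sequence `r` is a chain of `k`th power residues modulo `P`: the sums of its blocks of
consecutive terms are `k`th power residues modulo `P`, and are pairwise incongruent modulo `P`. -/
structure IsResidueChain {A : Type*} [CommRing A] (k : ℕ) (P : Ideal A) {m : ℕ}
    (r : Fin m → A) : Prop where
  isPowerResidue : ∀ i j : Fin m, i ≤ j → IsPowerResidue k P (∑ l ∈ Finset.Icc i j, r l)
  distinct : ∀ i j i' j' : Fin m, i ≤ j → i' ≤ j' →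
    (∑ l ∈ Finset.Icc i j, r l) - (∑ l ∈ Finset.Icc i' j', r l) ∈ P → i = i' ∧ j = j'

/-- The sequence `r` is a permutation chain of `k`th power residues modulo `P`: each of its
rearrangements is a chain of `k`th power residues modulo `P`. -/
def IsPermutationChain {A : Type*} [CommRing A] (k : ℕ) (P : Ideal A) {m : ℕ}
    (r : Fin m → A) : Prop :=
  ∀ σ : Equiv.Perm (Fin m), IsResidueChain k P (fun i => r (σ i))

/-- The sequence `r` is a permutation chain of `k`th power residues for infinitely many nonzero
prime ideals of `A`. -/
def IsPermutationChainInfinitelyOften {A : Type*} [CommRing A] (k : ℕ) {m : ℕ}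
    (r : Fin m → A) : Prop :=
  {P : Ideal A | P.IsPrime ∧ P ≠ ⊥ ∧ IsPermutationChain k P r}.Infinite

/-! Every block sum of every rearrangement is a subset sum of the sequence, and these finitely many
sums come from a small principal ideal domain `R`: `ℤ`, or `F[X]` with `X` acting as `t`. Distinct
subsets of the powers have distinct sums, so only finitely many primes of `R` make one of the
nonzero sums vanish or two sums collide. It remains to find infinitely many primes modulo which all
the sums are `k`th powers.

Adjoin `k`th roots of all the sums to `K`. No density theorem is needed: at a prime of degree one
over `R`, each root is congruent to an element of `R`. Such primes arise from Euclid's argument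
applied to the values of the minimal polynomial of an integral primitive element
(`Polynomial.exists_prime_dvd_eval`, `exists_prime_residue_surjective`). Inseparability is handled
by mapping the big field into its separable part with a power of Frobenius, and then undoing that
power in the perfect residue field (`exists_finitePrime_forall_dvd_pow_sub`).

For a function field, the bare existence claim also needs a transcendental `S`-integer. A counting
form of Riemann's inequality gives a nonconstant function whose poles lie only at one chosen prime
of `S` (`FinitePrime.exists_transcendental_forall_mem`). -/

open Polynomial IntermediateField
open scoped WithZero

/-! ### Primes of degree one -/

/-- A polynomial of positive degree over an infinite unique factorization domain with finitely
many units takes values divisible by primes outside any given finite set. -/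
theorem Polynomial.exists_prime_dvd_eval {R : Type*} [CommRing R] [IsDomain R]
    [UniqueFactorizationMonoid R] [Infinite R] [Finite Rˣ] (f : R[X]) (hf : 0 < f.natDegree)
    (d : R) (hd : d ≠ 0) : ∃ x q : R, Prime q ∧ ¬ q ∣ d ∧ q ∣ f.eval x := by
  obtain ⟨a, ha⟩ : ∃ a, f.eval a ≠ 0 := by
    by_contra! h
    have : f = 0 := Polynomial.funext (by simpa using h)
    simp [this] at hf
  set c := f.eval a with hc
  by_contra! H
  -- These values are `c` times a factor congruent to `1` modulo `d`. A prime dividing that factor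
  -- cannot divide `d`, so without new primes the factor is `0` or a unit. The polynomial would then
  -- take finitely many values at infinitely many points.
  have key : ∀ x : R, f.eval (a + c * d * x) ∈
      (Set.insert 0 (Set.range fun u : Rˣ => c * (u : R))) := by
    intro x
    obtain ⟨w, hw⟩ : c * d * x ∣ f.eval (a + c * d * x) - c := by
      have := f.sub_dvd_eval_sub (a + c * d * x) a
      rwa [add_sub_cancel_left] at this
    have hval : f.eval (a + c * d * x) = c * (1 + d * (x * w)) := by
      linear_combination hw
    rcases eq_or_ne (1 + d * (x * w)) 0 with h0 | h0
    · left; rw [hval, h0, mul_zero]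
    · right
      by_cases hu : IsUnit (1 + d * (x * w))
      · obtain ⟨u, hu⟩ := hu
        exact ⟨u, by simp [hval, hu]⟩
      · obtain ⟨q, hq, hqd⟩ := WfDvdMonoid.exists_irreducible_factor hu h0
        have hq' := hq.prime
        refine absurd (hval ▸ hqd.mul_left c) (H _ q hq' fun hqd' => hq'.not_isUnit ?_)
        exact isUnit_of_dvd_one ((dvd_add_left (hqd'.mul_right _)).1 hqd)
  have hfin : (Set.insert 0 (Set.range fun u : Rˣ => c * (u : R))).Finite :=
    (Set.finite_range _).insert 0
  have hinj : Function.Injective fun x : R => a + c * d * x := fun x y h =>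
    mul_left_cancel₀ (mul_ne_zero ha hd) (add_left_cancel h)
  have hpre : (⋃ v ∈ Set.insert 0 (Set.range fun u : Rˣ => c * (u : R)),
      {x : R | (f - C v).IsRoot x}).Finite := by
    refine hfin.biUnion fun v _ => Polynomial.finite_setOfPred_isRoot fun h => ?_
    rw [sub_eq_zero.1 h] at hf
    simp at hf
  refine Set.infinite_univ (((hpre.preimage hinj.injOn)).subset fun x _ => ?_)
  simp only [Set.mem_preimage, Set.mem_iUnion]
  exact ⟨_, key x, by simp [Polynomial.IsRoot]⟩

/-- Infinitely many primes of a finite separable extension have degree one over the base ring. -/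
theorem exists_prime_residue_surjective {R F₀ E : Type*} [CommRing R] [IsDomain R]
    [IsPrincipalIdealRing R] [Infinite R] [Finite Rˣ] [Field F₀] [Algebra R F₀]
    [IsFractionRing R F₀] [Field E] [Algebra F₀ E] [Algebra R E] [IsScalarTower R F₀ E]
    [FiniteDimensional F₀ E] [Algebra.IsSeparable F₀ E] (d : R) (hd : d ≠ 0) :
    ∃ (q : R) (Q : Ideal (integralClosure R E)), Prime q ∧ ¬ q ∣ d ∧ Q.IsPrime ∧
      algebraMap R _ q ∈ Q ∧ ∀ b, ∃ x : R, b - algebraMap R _ x ∈ Q := by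
  have hRE : Function.Injective (algebraMap R E) := by
    rw [IsScalarTower.algebraMap_eq R F₀ E]
    exact (algebraMap F₀ E).injective.comp (IsFractionRing.injective R F₀)
  have : FaithfulSMul R E := (faithfulSMul_iff_algebraMap_injective R E).2 hRE
  obtain ⟨α, hα⟩ := Field.exists_primitive_element F₀ E
  have hαR : IsAlgebraic R α :=
    (IsFractionRing.isAlgebraic_iff R F₀ E).2 (Algebra.IsAlgebraic.isAlgebraic α)
  obtain ⟨y, hy, hθ⟩ := hαR.exists_integral_multiple
  set θ := y • α with hθdef
  have hy' : algebraMap R F₀ y ≠ 0 := by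
    simpa using (IsFractionRing.injective R F₀).ne hy
  have hθ0 : IsIntegral F₀ θ := Algebra.IsIntegral.isIntegral θ
  have htop : F₀⟮θ⟯ = ⊤ := by
    rw [← top_le_iff, ← hα, adjoin_simple_le_iff]
    have h : (algebraMap R F₀ y)⁻¹ • θ ∈ F₀⟮θ⟯ := F₀⟮θ⟯.smul_mem (mem_adjoin_simple_self _ _)
    rwa [show (algebraMap R F₀ y)⁻¹ • θ = α by
      rw [hθdef, ← algebraMap_smul F₀ y α, inv_smul_smul₀ hy']] at h
  let B := (adjoin.powerBasis hθ0).map ((equivOfEq htop).trans topEquiv)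
  have hB : B.gen = θ := by simp [B]
  have hBint : IsIntegral R B.gen := by rwa [hB]
  -- The discriminant `c` is a common denominator: it carries the integral closure into `R[θ]`.
  -- Avoiding its prime factors makes `R[θ]` as good as the full integral closure.
  obtain ⟨c, hc⟩ : ∃ c : R, algebraMap R F₀ c = Algebra.discr F₀ B.basis :=
    IsIntegrallyClosed.isIntegral_iff.1 (Algebra.discr_isIntegral F₀ fun i => by
      rw [B.coe_basis]; exact hBint.pow _)
  have hc0 : c ≠ 0 := by
    rintro rfl
    exact Algebra.discr_not_zero_of_basis F₀ B.basis (by rw [← hc, map_zero])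
  have hcmul : ∀ b : integralClosure R E, ∃ g : R[X], aeval θ g = c • (b : E) := by
    intro b
    have := Algebra.discr_mul_isIntegral_mem_adjoin F₀ hBint b.2
    rw [← hc, algebraMap_smul, hB, Algebra.adjoin_singleton_eq_range_aeval] at this
    exact this
  obtain ⟨x, q, hq, hqd, hqx⟩ := (minpoly R θ).exists_prime_dvd_eval
    (minpoly.natDegree_pos hθ) (c * d) (mul_ne_zero hc0 hd)
  have hqc : ¬ q ∣ c := fun h => hqd (h.mul_right d)
  let θ' : integralClosure R E := ⟨θ, hθ⟩
  let I : Ideal (integralClosure R E) := Ideal.span {algebraMap R _ q, θ' - algebraMap R _ x}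
  -- A relation `b₁ q + b₂ (θ - x) = 1`, multiplied by `c`, becomes a polynomial congruence modulo
  -- `minpoly R θ`. Evaluating at `x`, where the minimal polynomial is divisible by `q`, yields `q ∣
  -- c`.
  have hI : I ≠ ⊤ := by
    intro h
    obtain ⟨b₁, b₂, hb⟩ := Ideal.mem_span_pair.1 ((Ideal.eq_top_iff_one I).1 h)
    obtain ⟨g₁, hg₁⟩ := hcmul b₁
    obtain ⟨g₂, hg₂⟩ := hcmul b₂
    have hb' : (b₁ : E) * algebraMap R E q + b₂ * (θ - algebraMap R E x) = 1 :=
      congrArg (Subtype.val) hb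
    have hroot : aeval θ (g₁ * C q + g₂ * (X - C x) - C c) = 0 := by
      simp only [map_sub, map_add, map_mul, aeval_C, aeval_X, hg₁, hg₂, Algebra.smul_def]
      linear_combination (algebraMap R E c) * hb'
    obtain ⟨g, hg⟩ := minpoly.isIntegrallyClosed_dvd hθ hroot
    have := congrArg (eval x) hg
    simp only [eval_sub, eval_add, eval_mul, eval_C, eval_X, sub_self, mul_zero, add_zero] at this
    apply hqc
    rw [show c = eval x g₁ * q - eval x (minpoly R θ) * eval x g by linear_combination -this]
    exact dvd_sub (dvd_mul_left _ _) (hqx.mul_right _)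
  obtain ⟨Q, hQ, hIQ⟩ := Ideal.exists_le_maximal I hI
  have hqQ : algebraMap R _ q ∈ Q := hIQ (Ideal.subset_span (by simp))
  have hθQ : θ' - algebraMap R _ x ∈ Q := hIQ (Ideal.subset_span (by simp))
  refine ⟨q, Q, hq, fun h => hqd (h.mul_left c), hQ.isPrime, hqQ, fun b => ?_⟩
  obtain ⟨g, hg⟩ := hcmul b
  have hcop : IsCoprime q c := (hq.irreducible.coprime_iff_not_dvd).2 hqc
  obtain ⟨u, v, huv⟩ := hcop
  have hg' : aeval θ' g = c • b :=
    Subtype.ext ((aeval_subalgebra_coe _ _ _).trans hg)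
  -- Modulo `Q`, `c b = g(θ) ≡ g(x)`, and `v` inverts `c`.
  refine ⟨v * g.eval x, ?_⟩
  have h1 : aeval θ' g - algebraMap R _ (g.eval x) ∈ Q := by
    have := (g.map (algebraMap R (integralClosure R E))).sub_dvd_eval_sub θ' (algebraMap R _ x)
    rw [eval_map_algebraMap, eval_map_algebraMap, aeval_algebraMap_apply] at this
    exact Q.mem_of_dvd (by simpa using this) hθQ
  have h2 : b = algebraMap R _ (u * q + v * c) * b := by rw [huv]; simp
  rw [hg', Algebra.smul_def] at h1
  have h3 : b - algebraMap R _ (v * eval x g) = algebraMap R _ u * b * algebraMap R _ q +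
      algebraMap R _ v * (algebraMap R _ c * b - algebraMap R _ (eval x g)) := by
    conv_lhs => rw [h2]
    simp only [map_add, map_mul]; ring
  rw [h3]
  exact Q.add_mem (Q.mul_mem_left _ hqQ) (Q.mul_mem_left _ h1)

/-! ### Finite primes modulo which given elements are powers -/

theorem Valuation.isDiscreteValuationRing_valuationSubring {K : Type*} [Field K]
    (v : Valuation K ℤᵐ⁰) {x : K} (hx0 : x ≠ 0) (hx : v x < 1) :
    IsDiscreteValuationRing v.valuationSubring := by
  have : v.IsNontrivial := ⟨x, by simpa using hx0, hx.ne⟩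
  infer_instance

/-- The finite prime of `K` induced by a maximal ideal of a Dedekind domain and an embedding of
`K` into the fraction field of that domain. -/
theorem FinitePrime.exists_of_embedding {B E K : Type*} [CommRing B] [IsDedekindDomain B]
    [Field E] [Algebra B E] [IsFractionRing B E] [Field K] (φ : K →+* E)
    (Q : Ideal B) [hQ : Q.IsPrime] {x₀ : K} {b₀ : B} (hb₀ : b₀ ∈ Q) (hb₀' : b₀ ≠ 0)
    (hx₀ : φ x₀ = algebraMap B E b₀) :
    ∃ V : FinitePrime K, ∀ (x : K) (b : B), φ x = algebraMap B E b →
      x ∈ V.1 ∧ (x ∈ V.1.nonunits ↔ b ∈ Q) := by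
  let w : IsDedekindDomain.HeightOneSpectrum B := ⟨Q, hQ, fun h => hb₀' (by simpa [h] using hb₀)⟩
  let v : Valuation K ℤᵐ⁰ := (w.valuation E).comap φ
  have hv : ∀ (x : K) (b : B), φ x = algebraMap B E b → v x ≤ 1 ∧ (v x < 1 ↔ b ∈ Q) := by
    intro x b h
    simp only [v, Valuation.comap_apply, h]
    exact ⟨w.valuation_le_one b, w.valuation_lt_one_iff_mem b⟩
  have hx₀0 : x₀ ≠ 0 := by
    rintro rfl
    rw [map_zero] at hx₀
    exact hb₀' ((map_eq_zero_iff _ (IsFractionRing.injective B E)).1 hx₀.symm)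
  refine ⟨⟨v.valuationSubring, v.isDiscreteValuationRing_valuationSubring hx₀0
    ((hv _ _ hx₀).2.2 hb₀)⟩, fun x b h => ⟨(hv x b h).1, ?_⟩⟩
  rw [ValuationSubring.mem_nonunits_iff, ← (hv x b h).2]
  exact (v.isEquiv_valuation_valuationSubring.lt_one_iff_lt_one).symm

section

variable {R K : Type*} (F₀ : Type*) [CommRing R] [IsDomain R] [IsPrincipalIdealRing R] [Infinite R]
  [Finite Rˣ] [Field F₀] [Algebra R F₀] [IsFractionRing R F₀] [Field K] [Algebra F₀ K]
  [Algebra R K] [IsScalarTower R F₀ K] [FiniteDimensional F₀ K]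

/-- Given finitely many elements of the base ring `R`, there are infinitely many primes `q` of `R`
below finite primes of `K` modulo which all of them are `k`th powers. -/
theorem exists_finitePrime_forall_dvd_pow_sub (p : ℕ) [ExpChar F₀ p]
    (hperf : ∀ q : R, Prime q → ∀ (n : ℕ) (x : R), ∃ z, q ∣ x - z ^ p ^ n)
    (T : Finset R) {k : ℕ} (hk : 0 < k) {d : R} (hd : d ≠ 0) :
    ∃ (q : R) (V : FinitePrime K), Prime q ∧ ¬ q ∣ d ∧
      (∀ x : R, algebraMap R K x ∈ V.1 ∧ (algebraMap R K x ∈ V.1.nonunits ↔ q ∣ x)) ∧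
      ∀ a ∈ T, ∃ z, q ∣ z ^ k - a := by
  classical
  let f : K[X] := ∏ a ∈ T, (X ^ k - C (algebraMap R K a))
  let L := f.SplittingField
  have : IsScalarTower R F₀ L := .of_algebraMap_eq fun x => by
    rw [IsScalarTower.algebraMap_apply F₀ K L, ← IsScalarTower.algebraMap_apply R F₀ K,
      ← IsScalarTower.algebraMap_apply R K L]
  have : FiniteDimensional F₀ L := .trans F₀ K L
  let E := separableClosure F₀ L
  let n := IsPurelyInseparable.exponent E L
  have : ExpChar E p := expChar_of_injective_algebraMap (algebraMap F₀ E).injective p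
  have : ExpChar R p := (algebraMap R F₀).expChar (IsFractionRing.injective R F₀) p
  have : IsScalarTower R E L := .of_algebraMap_eq fun x => by
    rw [IsScalarTower.algebraMap_apply R F₀ L, IsScalarTower.algebraMap_apply R F₀ E,
      ← IsScalarTower.algebraMap_apply F₀ E L]
  -- `φ` is `x ↦ x ^ p ^ n`, which lands in the separable part `E`. A prime of `E` is pulled back to
  -- `K` along it; in characteristic zero `p = 1` and nothing is twisted.
  let φ : L →+* E := IsPurelyInseparable.iterateFrobenius E L p (le_refl n)
  have hφ (x : L) : algebraMap E L (φ x) = x ^ p ^ n :=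
    IsPurelyInseparable.algebraMap_iterateFrobenius E p (le_refl n) x
  have hpn : p ^ n ≠ 0 := (pow_pos (expChar_pos F₀ p) n).ne'
  let B := integralClosure R E
  have : IsDedekindDomain B := integralClosure.isDedekindDomain R F₀ E
  have : IsFractionRing B E := integralClosure.isFractionRing_of_finite_extension F₀ E
  obtain ⟨q, Q, hq, hqd, hQ, hqQ, hres⟩ :=
    exists_prime_residue_surjective (F₀ := F₀) (E := E) d hd
  have hφR (x : R) : φ (algebraMap R L x) = algebraMap B E (algebraMap R B (x ^ p ^ n)) := by
    apply (algebraMap E L).injective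
    rw [hφ, ← IsScalarTower.algebraMap_apply R B E, ← IsScalarTower.algebraMap_apply R E L,
      map_pow]
  have hRB : Function.Injective (algebraMap R B) := by
    have : Function.Injective (algebraMap R E) := by
      rw [IsScalarTower.algebraMap_eq R F₀ E]
      exact (algebraMap F₀ E).injective.comp (IsFractionRing.injective R F₀)
    rw [IsScalarTower.algebraMap_eq R B E, RingHom.coe_comp] at this
    exact Function.Injective.of_comp this
  have hcomap (x : R) : algebraMap R B x ∈ Q ↔ q ∣ x := by
    have hmax : (Ideal.span {q}).IsMaximal :=
      PrincipalIdealRing.isMaximal_of_irreducible hq.irreducible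
    have hle : Ideal.span {q} ≤ Q.comap (algebraMap R B) := by
      rw [Ideal.span_singleton_le_iff_mem]; exact hqQ
    rw [← Ideal.mem_comap, ← hmax.eq_of_le (hQ.comap _).ne_top hle, Ideal.mem_span_singleton]
  have hpow (x : R) : algebraMap R B (x ^ p ^ n) ∈ Q ↔ q ∣ x := by
    rw [hcomap, hq.dvd_pow_iff_dvd hpn]
  obtain ⟨V, hV⟩ := FinitePrime.exists_of_embedding (φ.comp (algebraMap K L)) Q
    ((hpow q).2 dvd_rfl) ((map_ne_zero_iff _ hRB).2 (pow_ne_zero _ hq.ne_zero))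
    (x₀ := algebraMap R K q) (by
      rw [RingHom.comp_apply, ← IsScalarTower.algebraMap_apply R K L, hφR])
  refine ⟨q, V, hq, hqd, fun x => ?_, fun a ha => ?_⟩
  · rw [← hpow]
    exact hV _ _ (by rw [RingHom.comp_apply, ← IsScalarTower.algebraMap_apply R K L, hφR])
  · obtain ⟨α, hα⟩ : ∃ α : L, α ^ k = algebraMap R L a := by
      have hsp : ((X ^ k - C (algebraMap R K a)).map (algebraMap K L)).Splits := by
        refine Splits.of_dvd (SplittingField.splits f) ?_ (Polynomial.map_dvd _
          (Finset.dvd_prod_of_mem _ ha))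
        rw [Polynomial.map_ne_zero_iff (algebraMap K L).injective]
        exact Finset.prod_ne_zero_iff.2 fun b _ => X_pow_sub_C_ne_zero hk _
      obtain ⟨α, hα⟩ := hsp.exists_eval_eq_zero (by
        rw [degree_map, degree_X_pow_sub_C hk]; exact_mod_cast hk.ne')
      refine ⟨α, ?_⟩
      rw [IsScalarTower.algebraMap_apply R K L]
      simpa [sub_eq_zero] using hα
    have hαint : IsIntegral R (φ α) := by
      have h1 : IsIntegral R α := .of_pow hk (hα ▸ isIntegral_algebraMap)
      have h2 : IsIntegral R (algebraMap E L (φ α)) := hφ α ▸ h1.pow _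
      exact (isIntegral_algebraMap_iff (algebraMap E L).injective).1 h2
    -- Degree one gives `φ α ≡ x ≡ z ^ p ^ n`. Hence `(z ^ k) ^ p ^ n ≡ a ^ p ^ n`, and additivity
    -- of Frobenius turns this into `(z ^ k - a) ^ p ^ n ≡ 0`.
    obtain ⟨x, hx⟩ := hres ⟨φ α, hαint⟩
    obtain ⟨z, hz⟩ := hperf q hq n x
    refine ⟨z, ?_⟩
    rw [← hq.dvd_pow_iff_dvd hpn, sub_pow_expChar_pow, ← hcomap]
    have hb : (⟨φ α, hαint⟩ : B) ^ k = algebraMap R B (a ^ p ^ n) := by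
      apply IsFractionRing.injective B E
      rw [← hφR, ← hα, map_pow, map_pow]; rfl
    have h1 : (⟨φ α, hαint⟩ : B) - algebraMap R B (z ^ p ^ n) ∈ Q := by
      have := Q.add_mem hx ((hcomap _).2 hz)
      rwa [map_sub, sub_add_sub_cancel] at this
    have h2 := Q.mem_of_dvd (sub_dvd_pow_sub_pow _ _ k) h1
    rw [hb, ← map_pow, ← map_sub, ← pow_mul, mul_comm, pow_mul] at h2
    rw [← neg_mem_iff, ← map_neg, neg_sub]
    exact h2

end

/-! ### From primes to permutation chains -/

section

variable {R K : Type*} (F₀ : Type*) [CommRing R] [IsDomain R] [IsPrincipalIdealRing R] [Infinite R]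
  [Finite Rˣ] [Field F₀] [Algebra R F₀] [IsFractionRing R F₀] [Field K] [Algebra F₀ K]
  [Algebra R K] [IsScalarTower R F₀ K] [FiniteDimensional F₀ K]

/-- A sequence with pairwise distinct subset sums in a base ring contained in the ring of
`S`-integers is a permutation chain of `k`th power residues infinitely often. -/
theorem isPermutationChainInfinitelyOften_of_subsetSum_injective (p : ℕ) [ExpChar F₀ p]
    (hperf : ∀ q : R, Prime q → ∀ (n : ℕ) (x : R), ∃ z, q ∣ x - z ^ p ^ n)
    (S : Finset (FinitePrime K)) (ι : R →+* SIntegerRing S)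
    (hι : ∀ x, (ι x : K) = algebraMap R K x) {k : ℕ} (hk : 0 < k) {m : ℕ} (r : Fin m → R)
    (hr : Function.Injective fun s : Finset (Fin m) => ∑ i ∈ s, r i) :
    IsPermutationChainInfinitelyOften k (fun i => ι (r i)) := by
  classical
  have hr0 {s : Finset (Fin m)} (hs : s.Nonempty) : ∑ i ∈ s, r i ≠ 0 := fun h =>
    hs.ne_empty (hr (by simpa using h))
  refine Set.Infinite.of_image (Ideal.comap ι) fun hfin => ?_
  set 𝒢 := Ideal.comap ι '' {P | P.IsPrime ∧ P ≠ ⊥ ∧ IsPermutationChain k P fun i => ι (r i)}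
  have he : ∀ I : Ideal R, ∃ e : R, e ≠ 0 ∧ (I ≠ ⊥ → e ∈ I) := by
    intro I
    by_cases hI : I = ⊥
    · exact ⟨1, one_ne_zero, fun h => absurd hI h⟩
    · obtain ⟨x, hx, hx0⟩ := Submodule.exists_mem_ne_zero_of_ne_bot hI
      exact ⟨x, hx0, fun _ => hx⟩
  have hε : ∀ V : FinitePrime K, ∃ e : R, e ≠ 0 ∧
      ∀ q : R, Prime q → (∀ x, algebraMap R K x ∈ V.1.nonunits ↔ q ∣ x) → q ∣ e := by
    intro V
    by_cases hV : ∃ q : R, Prime q ∧ ∀ x, algebraMap R K x ∈ V.1.nonunits ↔ q ∣ x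
    · obtain ⟨q, hq, h⟩ := hV
      exact ⟨q, hq.ne_zero, fun q' _ h' => (h' q).1 ((h q).2 dvd_rfl)⟩
    · exact ⟨1, one_ne_zero, fun q hq h => (hV ⟨q, hq, h⟩).elim⟩
  choose e he0 he using he
  choose ε hε0 hε using hε
  let T : Finset R := Finset.univ.image fun s : Finset (Fin m) => ∑ i ∈ s, r i
  -- A prime `q ∤ d` keeps the nonzero sums nonzero and distinct sums distinct. It also differs from
  -- the contractions already listed (through `e`) and from the primes below `S` (through `ε`).
  let d : R := ((∏ a ∈ T.erase 0, a) * ∏ u ∈ T.offDiag, (u.1 - u.2)) *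
    ((∏ I ∈ hfin.toFinset, e I) * ∏ V ∈ S, ε V)
  have hd : d ≠ 0 := by
    refine mul_ne_zero (mul_ne_zero ?_ ?_) (mul_ne_zero ?_ ?_) <;> rw [Finset.prod_ne_zero_iff]
    · exact fun a ha => Finset.ne_of_mem_erase ha
    · exact fun u hu => sub_ne_zero.2 (Finset.mem_offDiag.1 hu).2.2
    · exact fun I _ => he0 I
    · exact fun V _ => hε0 V
  obtain ⟨q, V, hq, hqd, hV, hT⟩ :=
    exists_finitePrime_forall_dvd_pow_sub F₀ (K := K) p hperf T hk hd
  have hVS : V ∉ S := fun h => hqd <| (((hε V q hq fun x => (hV x).2).trans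
    (Finset.dvd_prod_of_mem ε h)).mul_left _).mul_left _
  have hAV : SIntegerRing S ≤ V.1.toSubring := fun x hx => hx V hVS
  let P : Ideal (SIntegerRing S) :=
    (IsLocalRing.maximalIdeal V.1).comap (Subring.inclusion hAV : SIntegerRing S →+* V.1)
  have hP (x : R) : ι x ∈ P ↔ q ∣ x := by
    rw [← (hV x).2, ← hι, Ideal.mem_comap, ← ValuationSubring.coe_mem_nonunits_iff]
    rfl
  have hblock (σ : Equiv.Perm (Fin m)) (i j : Fin m) : ∑ l ∈ Finset.Icc i j, ι (r (σ l)) =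
      ι (∑ l ∈ (Finset.Icc i j).map σ.toEmbedding, r l) := by
    rw [map_sum, Finset.sum_map]; rfl
  have hTmem (s : Finset (Fin m)) : ∑ i ∈ s, r i ∈ T :=
    Finset.mem_image_of_mem _ (Finset.mem_univ s)
  have hPmem : P.comap ι ∈ 𝒢 := by
    refine ⟨P, ⟨Ideal.IsPrime.comap _, fun h => ?_, fun σ => ⟨fun i j hij => ?_,
      fun i j i' j' hij hij' h => ?_⟩⟩, rfl⟩
    · have h1 : ι q ∈ P := (hP q).2 dvd_rfl
      have h2 : algebraMap R K q = 0 := by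
        rw [← hι, (Ideal.mem_bot.1 (h ▸ h1 : ι q ∈ (⊥ : Ideal _))), ZeroMemClass.coe_zero]
      rw [IsScalarTower.algebraMap_apply R F₀ K, map_eq_zero,
        map_eq_zero_iff _ (IsFractionRing.injective R F₀)] at h2
      exact hq.ne_zero h2
    · rw [hblock]
      set s := (Finset.Icc i j).map σ.toEmbedding
      have hs : s.Nonempty := (Finset.nonempty_Icc.2 hij).map
      refine ⟨fun h => hqd (((((hP _).1 h).trans (Finset.dvd_prod_of_mem (fun a => a)
        (Finset.mem_erase.2 ⟨hr0 hs, hTmem s⟩))).mul_right _).mul_right _), ?_⟩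
      obtain ⟨z, hz⟩ := hT _ (hTmem s)
      exact ⟨ι z, by rw [← map_pow, ← map_sub]; exact (hP _).2 hz⟩
    · rw [hblock, hblock, ← map_sub, hP] at h
      set s := (Finset.Icc i j).map σ.toEmbedding
      set s' := (Finset.Icc i' j').map σ.toEmbedding
      have hss' : s = s' := by
        by_contra hne
        refine hqd (((h.trans (Finset.dvd_prod_of_mem (a := (∑ i ∈ s, r i, ∑ i ∈ s', r i))
          (fun u : R × R => u.1 - u.2)
          (Finset.mem_offDiag.2 ⟨hTmem s, hTmem s', hr.ne hne⟩))).mul_left _).mul_right _)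
      have hIcc := Finset.map_injective _ hss'
      have h1 := Finset.mem_Icc.1 (hIcc ▸ Finset.left_mem_Icc.2 hij)
      have h2 := Finset.mem_Icc.1 (hIcc ▸ Finset.right_mem_Icc.2 hij)
      have h3 := Finset.mem_Icc.1 (hIcc ▸ Finset.left_mem_Icc.2 hij' : i' ∈ Finset.Icc i j)
      have h4 := Finset.mem_Icc.1 (hIcc ▸ Finset.right_mem_Icc.2 hij' : j' ∈ Finset.Icc i j)
      exact ⟨le_antisymm h3.1 h1.1, le_antisymm h2.2 h4.2⟩
  have hne : P.comap ι ≠ ⊥ := fun h => hq.ne_zero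
    (Ideal.mem_bot.1 (h ▸ Ideal.mem_comap.2 ((hP q).2 dvd_rfl) : q ∈ (⊥ : Ideal R)))
  exact hqd <| ((((hP _).1 (he _ hne)).trans (Finset.dvd_prod_of_mem e
    (hfin.mem_toFinset.2 hPmem))).mul_right _).mul_left _

end

/-! ### The two base rings: polynomials over a finite field, and the integers -/

theorem isAlgebraic_constantField_iff_bot {K : Type*} [Field K] {t : K} :
    IsAlgebraic (constantField K) t ↔ IsAlgebraic (⊥ : Subfield K) t := by
  set k : Subfield K := ⊥ with hk
  have := Algebra.IsAlgebraic.isAlgebraic_iff k (algebraicClosure k K) (a := t)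
  exact this.symm

theorem isAlgebraic_constantField_iff {F K : Type*} [Field F] [Finite F] [Field K] [Algebra F K]
    {t : K} : IsAlgebraic (constantField K) t ↔ IsAlgebraic F t := by
  let e : F ≃+* (algebraMap F K).fieldRange :=
    RingEquiv.ofBijective (algebraMap F K).rangeRestrictField
      ⟨(algebraMap F K).rangeRestrictField.injective,
        (algebraMap F K).rangeRestrictField_bijective.2⟩
  let : Algebra (⊥ : Subfield K) F :=
    (e.symm.toRingHom.comp (Subfield.inclusion bot_le)).toAlgebra
  have : IsScalarTower (⊥ : Subfield K) F K := .of_algebraMap_eq fun x =>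
    congrArg Subtype.val (e.apply_symm_apply (Subfield.inclusion bot_le x)).symm
  have : Algebra.IsAlgebraic (⊥ : Subfield K) F := Algebra.IsAlgebraic.of_finite _ _
  rw [isAlgebraic_constantField_iff_bot,
    ← Algebra.IsAlgebraic.isAlgebraic_iff (⊥ : Subfield K) F]

theorem IsGlobalFunctionField.exists_finite_field {K : Type*} [Field K]
    (hK : IsGlobalFunctionField K) : ∃ (F : Type) (_ : Field F) (_ : Finite F) (_ : Algebra F K),
      ∀ t : K, Transcendental F t → FiniteDimensional F⟮t⟯ K := by
  obtain ⟨F, _, hF, _, hFK⟩ := hK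
  let : Algebra F K := ((algebraMap (RatFunc F) K).comp (algebraMap F (RatFunc F))).toAlgebra
  have : IsScalarTower F (RatFunc F) K := .of_algebraMap_eq fun _ => rfl
  exact ⟨F, _, hF, _, fun t ht => FunctionField.finiteDimensional_of_adjoin_transcendental ht⟩

theorem Polynomial.sum_X_pow_injective (F : Type*) [Semiring F] [Nontrivial F] (m : ℕ) :
    Function.Injective fun s : Finset (Fin m) => ∑ i ∈ s, (X : F[X]) ^ (i : ℕ) := by
  classical
  intro s s' h
  ext i
  have := congrArg (fun p => p.coeff (i : ℕ)) h
  simp only [finsetSum_coeff, coeff_X_pow, Fin.val_inj, Finset.sum_ite_eq] at this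
  by_cases h1 : i ∈ s <;> by_cases h2 : i ∈ s' <;> simp_all

theorem ValuationSubring.mem_of_isIntegral {K : Type*} [Field K] (V : ValuationSubring K) {x : K}
    (hx : IsIntegral V x) : x ∈ V := by
  obtain ⟨y, rfl⟩ := IsIntegrallyClosed.isIntegral_iff.1 hx
  exact y.2

theorem ValuationSubring.algebraMap_mem_of_finite {F K : Type*} [Field F] [Finite F] [Field K]
    [Algebra F K] (V : ValuationSubring K) (a : F) : algebraMap F K a ∈ V := by
  have h : IsIntegral ℤ (algebraMap F K a) :=
    (IsIntegral.of_finite ℤ a).map (algebraMap F K).toIntAlgHom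
  exact V.mem_of_isIntegral h.tower_top

theorem ValuationSubring.aeval_mem_of_finite {F K : Type*} [Field F] [Finite F] [Field K]
    [Algebra F K] (V : ValuationSubring K) {t : K} (ht : t ∈ V) (f : F[X]) : aeval t f ∈ V := by
  rw [aeval_eq_sum_range]
  refine sum_mem fun i _ => ?_
  rw [Algebra.smul_def]
  exact V.mul_mem _ _ (V.algebraMap_mem_of_finite _) (pow_mem ht _)

instance Polynomial.finite_units {F : Type*} [Field F] [Finite F] : Finite F[X]ˣ := by
  refine .of_injective (fun u => (u : F[X]).coeff 0) fun u v (h : (u : F[X]).coeff 0 = _) =>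
    Units.ext ?_
  rw [eq_C_of_degree_eq_zero (degree_coe_units u), eq_C_of_degree_eq_zero (degree_coe_units v), h]

/-- The residue field `F[X]/(q)` is finite, so its Frobenius is bijective. -/
theorem Polynomial.exists_dvd_sub_pow_expChar_pow {F : Type*} [Field F] [Finite F] (p : ℕ)
    [ExpChar F p] {q : F[X]} (hq : Prime q) (n : ℕ) (x : F[X]) : ∃ z, q ∣ x - z ^ p ^ n := by
  have : Fact (Irreducible q) := ⟨hq.irreducible⟩
  have : Module.Finite F (AdjoinRoot q) := (AdjoinRoot.powerBasis hq.ne_zero).finite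
  have : Finite (AdjoinRoot q) := Module.finite_of_finite F
  have : ExpChar (AdjoinRoot q) p :=
    expChar_of_injective_algebraMap (algebraMap F (AdjoinRoot q)).injective p
  obtain ⟨y, hy⟩ := Finite.surjective_of_injective (iterateFrobenius (AdjoinRoot q) p n).injective
    (AdjoinRoot.mk q x)
  obtain ⟨z, rfl⟩ := AdjoinRoot.mk_surjective y
  exact ⟨z, by rw [← AdjoinRoot.mk_eq_zero, map_sub, map_pow, ← hy, iterateFrobenius_def, sub_self]⟩

/-- A function field `K` over `F` as a finite extension of `F(X)` with `X` acting as a given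
transcendental element. -/
theorem exists_algebra_ratFunc_of_transcendental {F K : Type*} [Field F] [Field K] [Algebra F K]
    {t : K} (ht : Transcendental F t) [FiniteDimensional F⟮t⟯ K] :
    ∃ (_ : Algebra F[X] K) (_ : IsScalarTower F F[X] K) (_ : Algebra (RatFunc F) K)
      (_ : IsScalarTower F[X] (RatFunc F) K),
      FiniteDimensional (RatFunc F) K ∧ ∀ f : F[X], algebraMap F[X] K f = aeval t f := by
  let e := RatFunc.algEquivOfTranscendental t ht
  let i₁ : Algebra F[X] K := (aeval (R := F) t).toAlgebra
  let i₂ : Algebra (RatFunc F) K := ((algebraMap F⟮t⟯ K).comp (e : RatFunc F →+* F⟮t⟯)).toAlgebra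
  refine ⟨i₁, .of_algebraMap_eq fun a => (aeval_C (R := F) t a).symm, i₂,
    .of_algebraMap_eq fun f => ?_, ?_, fun _ => rfl⟩
  · change aeval t f = algebraMap F⟮t⟯ K (e (algebraMap F[X] (RatFunc F) f))
    rw [RatFunc.algEquivOfTranscendental_algebraMap, ← aeval_algebraMap_apply]
    rfl
  · exact Module.Finite.of_equiv_equiv e.symm.toRingEquiv (RingEquiv.refl K) (by
      ext x
      exact congrArg (algebraMap F⟮t⟯ K) (e.apply_symm_apply x))

theorem isPermutationChainInfinitelyOften_pow_of_transcendental {K : Type*} [Field K]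
    (hK : IsGlobalFunctionField K) (S : Finset (FinitePrime K)) {k : ℕ} (hk : 0 < k) (m : ℕ)
    (t : SIntegerRing S) (ht : Transcendental (constantField K) (t : K)) :
    IsPermutationChainInfinitelyOften k (fun i : Fin m => t ^ (i : ℕ)) := by
  obtain ⟨F, _, hF, _, hfin⟩ := hK.exists_finite_field
  replace ht : Transcendental F (t : K) := fun h => ht (isAlgebraic_constantField_iff.2 h)
  have := hfin t ht
  let ι : F[X] →+* SIntegerRing S :=
    (aeval (R := F) (t : K)).toRingHom.codRestrict (SIntegerRing S) fun f V hV =>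
      V.1.aeval_mem_of_finite (t.2 V hV) f
  obtain ⟨_, _, _, _, _, hX⟩ := exists_algebra_ratFunc_of_transcendental ht
  obtain ⟨p, hp⟩ := ExpChar.exists F
  have : ExpChar (RatFunc F) p := expChar_of_injective_algebraMap (algebraMap F _).injective p
  convert isPermutationChainInfinitelyOften_of_subsetSum_injective (RatFunc F) p
    (fun q hq n x => exists_dvd_sub_pow_expChar_pow p hq n x) S ι
    (fun f => (hX f).symm) hk _ (sum_X_pow_injective F m) with i
  exact Subtype.ext (by simp [ι])

theorem isPermutationChainInfinitelyOften_natCast_pow {K : Type*} [Field K] [NumberField K]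
    (S : Finset (FinitePrime K)) {k : ℕ} (hk : 0 < k) (m : ℕ) {p : ℕ} (hp : 2 ≤ p) :
    IsPermutationChainInfinitelyOften k (fun i : Fin m => (p : SIntegerRing S) ^ (i : ℕ)) := by
  -- Exponential characteristic `1` makes every Frobenius power the identity, so the perfectness
  -- condition is trivial.
  have : ExpChar ℚ 1 := .zero
  have h : Function.Injective fun s : Finset (Fin m) => ∑ i ∈ s, (p : ℤ) ^ (i : ℕ) := by
    intro s s' h
    apply Finset.map_injective Fin.valEmbedding
    apply Finset.geomSum_injective hp
    simp only [Finset.sum_map, Fin.valEmbedding_apply]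
    beta_reduce at h
    exact_mod_cast h
  convert isPermutationChainInfinitelyOften_of_subsetSum_injective ℚ 1
    (fun q _ n x => ⟨x, by simp⟩) S (Int.castRingHom _) (fun x => by simp) hk _ h with i
  simp

/-! ### Weak approximation for finite primes -/

namespace FinitePrime

variable {K : Type*} [Field K]

theorem exists_ne_zero_mem_nonunits (V : FinitePrime K) : ∃ x ≠ 0, x ∈ V.1.nonunits := by
  have := V.2
  obtain ⟨ϖ, hϖ⟩ := IsDiscreteValuationRing.exists_irreducible V.1
  refine ⟨ϖ, by simpa using hϖ.ne_zero, ?_⟩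
  rw [ValuationSubring.coe_mem_nonunits_iff, hϖ.maximalIdeal_eq]
  exact Ideal.mem_span_singleton_self ϖ

/-- The valuation of a finite prime is archimedean. -/
theorem exists_forall_pow_mul_mem_nonunits (V : FinitePrime K) {x : K} (hx : x ∈ V.1.nonunits)
    (y : K) : ∃ N : ℕ, ∀ n ≥ N, x ^ n * y ∈ V.1.nonunits := by
  have := V.2
  suffices h : ∃ N : ℕ, x ^ N * y ∈ V.1 by
    obtain ⟨N, hN⟩ := h
    refine ⟨N + 1, fun n hn => ?_⟩
    obtain ⟨d, rfl⟩ := Nat.exists_eq_add_of_le hn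
    rw [ValuationSubring.mem_nonunits_iff] at *
    rw [← ValuationSubring.valuation_le_one_iff] at hN
    rw [show x ^ (N + 1 + d) * y = x ^ (d + 1) * (x ^ N * y) by ring, map_mul]
    exact mul_lt_one_of_lt_of_le (by rw [map_pow]; exact pow_lt_one₀ zero_le hx (by simp)) hN
  rcases V.1.mem_or_inv_mem y with hy | hy
  · exact ⟨0, by simpa using hy⟩
  rcases eq_or_ne y 0 with rfl | hy0
  · exact ⟨0, by simp [V.1.zero_mem]⟩
  -- The order `N` of the pole of `y` suffices, since `ϖ` divides `x`.
  obtain ⟨ϖ, hϖ⟩ := IsDiscreteValuationRing.exists_irreducible V.1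
  obtain ⟨N, u, hu⟩ := IsDiscreteValuationRing.eq_unit_mul_pow_irreducible
    (x := (⟨y⁻¹, hy⟩ : V.1)) (fun h => inv_ne_zero hy0 (congrArg Subtype.val h)) hϖ
  have hxV : x ∈ V.1 := ValuationSubring.nonunits_subset hx
  have hϖx : ϖ ∣ ⟨x, hxV⟩ := by
    rw [← Ideal.mem_span_singleton, ← hϖ.maximalIdeal_eq, ← ValuationSubring.coe_mem_nonunits_iff]
    exact hx
  have hdvd : (⟨y⁻¹, hy⟩ : V.1) ∣ ⟨x, hxV⟩ ^ N := by
    rw [hu, Units.mul_left_dvd]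
    exact pow_dvd_pow_of_dvd hϖx N
  obtain ⟨w, hw⟩ := hdvd
  refine ⟨N, ?_⟩
  have hw' : x ^ N = y⁻¹ * w := congrArg Subtype.val hw
  rw [hw', mul_right_comm, inv_mul_cancel₀ hy0, one_mul]
  exact w.2

theorem exists_mem_notMem {V W : FinitePrime K} (h : V ≠ W) : ∃ x ∈ V.1, x ∉ W.1 := by
  by_contra! hle
  obtain ⟨w, hwW, hwV⟩ : ∃ w ∈ W.1, w ∉ V.1 := by
    by_contra! hle'
    exact h (Subtype.ext (SetLike.ext fun x => ⟨hle x, hle' x⟩))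
  have hw0 : w ≠ 0 := fun h0 => hwV (h0 ▸ V.1.zero_mem)
  have hw : w⁻¹ ∈ V.1.nonunits := V.1.inv_mem_nonunits_iff.2 (Or.inr hwV)
  obtain ⟨x, hx0, hx⟩ := W.exists_ne_zero_mem_nonunits
  obtain ⟨N, hN⟩ := V.exists_forall_pow_mul_mem_nonunits hw x⁻¹
  have h1 := W.1.mul_mem _ _ (pow_mem hwW N)
    (hle _ (ValuationSubring.nonunits_subset (hN N le_rfl)))
  rw [← mul_assoc, ← mul_pow, mul_inv_cancel₀ hw0, one_pow, one_mul] at h1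
  exact (W.1.mem_nonunits_iff_or.1 hx).elim hx0 (· h1)

/-- Weak approximation: an element with a pole at one finite prime and zeros at finitely many
others. -/
theorem exists_notMem_forall_mem_nonunits (V : FinitePrime K) (D : Finset (FinitePrime K))
    (hV : V ∉ D) : ∃ z, z ∉ V.1 ∧ ∀ W ∈ D, z ∈ W.1.nonunits := by
  classical
  induction D using Finset.induction_on with
  | empty =>
    obtain ⟨x, hx0, hx⟩ := V.exists_ne_zero_mem_nonunits
    exact ⟨x⁻¹, (V.1.mem_nonunits_iff_or.1 hx).resolve_left hx0, by simp⟩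
  | insert W D hW ih =>
    rw [Finset.mem_insert, not_or] at hV
    obtain ⟨z, hzV, hz⟩ := ih hV.2
    obtain ⟨a, haV, haW⟩ := exists_mem_notMem hV.1
    obtain ⟨b, hbW, hbV⟩ := exists_mem_notMem (Ne.symm hV.1)
    have lt_iff (U : FinitePrime K) (x : K) : x ∉ U.1 ↔ 1 < U.1.valuation x := by
      rw [← ValuationSubring.valuation_le_one_iff, not_le]
    -- `w` has a pole at `V` and a zero at `W`. If `z` is regular at `W`, `z ^ n * w` works;
    -- otherwise replace `z ^ n` by `z ^ n / (1 + z ^ n)`, which is a unit at `V` and `W` and still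
    -- small on `D`.
    set w := b / a with hw
    have hwV : 1 < V.1.valuation w := by
      rw [hw, map_div₀]
      rw [lt_iff] at hbV
      rw [← ValuationSubring.valuation_le_one_iff] at haV
      have ha0 : V.1.valuation a ≠ 0 := by
        rw [Valuation.ne_zero_iff]; rintro rfl; exact haW W.1.zero_mem
      rw [one_lt_div₀ (zero_lt_iff.2 ha0)]
      exact haV.trans_lt hbV
    have hwW : W.1.valuation w < 1 := by
      rw [hw, map_div₀]
      rw [lt_iff] at haW
      rw [← ValuationSubring.valuation_le_one_iff] at hbW
      rw [div_lt_one₀ (zero_lt_one.trans haW)]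
      exact hbW.trans_lt haW
    have hN : ∀ U ∈ D, ∃ N : ℕ, ∀ n ≥ N, z ^ n * w ∈ U.1.nonunits := fun U hU =>
      U.exists_forall_pow_mul_mem_nonunits (hz U hU) w
    choose! N hN using hN
    set n := D.sup N + 1
    have hn : ∀ U ∈ D, z ^ n * w ∈ U.1.nonunits := fun U hU =>
      hN U hU n ((Finset.le_sup hU).trans (Nat.le_succ _))
    simp only [ValuationSubring.mem_nonunits_iff, Finset.mem_insert, forall_eq_or_imp] at hn hz ⊢
    simp only [lt_iff] at hzV ⊢
    by_cases hzW : z ∈ W.1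
    · refine ⟨z ^ n * w, ?_, ?_, hn⟩
      · rw [map_mul, map_pow]
        exact one_lt_mul_of_le_of_lt (one_le_pow₀ hzV.le) hwV
      · rw [map_mul, map_pow, mul_comm]
        rw [← ValuationSubring.valuation_le_one_iff] at hzW
        exact mul_lt_one_of_lt_of_le hwW (pow_le_one₀ zero_le hzW)
    · rw [lt_iff] at hzW
      have big (U : FinitePrime K) (hU : 1 < U.1.valuation z) :
          U.1.valuation (z ^ n / (1 + z ^ n)) = 1 := by
        have h1 : 1 < U.1.valuation (z ^ n) := by
          rw [map_pow]; exact one_lt_pow₀ hU (by simp [n])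
        rw [map_div₀, Valuation.map_add_eq_of_lt_right _ (by rwa [map_one]),
          div_self (zero_lt_one.trans h1).ne']
      refine ⟨z ^ n / (1 + z ^ n) * w, ?_, ?_, fun U hU => ?_⟩
      · rwa [map_mul, big V hzV, one_mul]
      · rwa [map_mul, big W hzW, one_mul]
      · have h1 : U.1.valuation (z ^ n) < 1 := by
          rw [map_pow]; exact pow_lt_one₀ zero_le (hz U hU) (by simp [n])
        rw [div_mul_eq_mul_div, map_div₀, Valuation.map_one_add_of_lt _ h1, div_one]
        exact hn U hU

/-- Weak approximation: an element congruent to `1` at one finite prime and to `0` at finitely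
many others. -/
theorem exists_sub_one_mem_nonunits (V : FinitePrime K) (D : Finset (FinitePrime K))
    (hV : V ∉ D) : ∃ e, e - 1 ∈ V.1.nonunits ∧ ∀ W ∈ D, e ∈ W.1.nonunits := by
  obtain ⟨z, hzV, hz⟩ := V.exists_notMem_forall_mem_nonunits D hV
  rw [← ValuationSubring.valuation_le_one_iff, not_le] at hzV
  simp only [ValuationSubring.mem_nonunits_iff] at hz ⊢
  have h1 : V.1.valuation (1 + z) = V.1.valuation z :=
    Valuation.map_add_eq_of_lt_right V.1.valuation (by rwa [map_one])
  have h0 : 1 + z ≠ 0 := by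
    rw [← Valuation.ne_zero_iff V.1.valuation, h1]; exact (zero_lt_one.trans hzV).ne'
  refine ⟨z / (1 + z), ?_, fun W hW => ?_⟩
  · rw [show z / (1 + z) - 1 = -(1 + z)⁻¹ by field_simp; ring, Valuation.map_neg, map_inv₀, h1]
    exact inv_lt_one_of_one_lt₀ hzV
  · rw [map_div₀, Valuation.map_one_add_of_lt _ (hz W hW), div_one]
    exact hz W hW

end FinitePrime

/-! ### Lattices over `F[X]` and their indices -/

section

variable {F K : Type*} [Field F] [Field K] [Algebra F[X] K]

variable (F K) in
/-- Multiplication by a power of `X` on `K`. -/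
noncomputable def mulXPow (n : ℕ) : K →+ K :=
  AddMonoidHom.mulLeft (algebraMap F[X] K X ^ n)

theorem mulXPow_injective [FaithfulSMul F[X] K] (n : ℕ) : Function.Injective (mulXPow F K n) := by
  refine mul_right_injective₀ (pow_ne_zero n ?_)
  simp

theorem map_mulXPow_le (N : Submodule F[X] K) (n : ℕ) :
    N.toAddSubgroup.map (mulXPow F K n) ≤ N.toAddSubgroup := by
  rintro _ ⟨x, hx, rfl⟩
  have := N.smul_mem (X ^ n) hx
  rwa [Algebra.smul_def, map_pow] at this

end

section

variable {F K : Type*} [Field F] [Field K] [Algebra F K] [Algebra F[X] K] [IsScalarTower F F[X] K]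
  [FaithfulSMul F[X] K]

/-- Elements of an `F[X]`-lattice that are linearly independent over `F` modulo `X` are linearly
independent over `F[X]`. -/
theorem linearIndependent_polynomial_of_forall_mem {ι : Type*} (N : Submodule F[X] K) (y : ι → K)
    (hy : ∀ i, y i ∈ N)
    (h : ∀ (s : Finset ι) (a : ι → F), (∃ z ∈ N, ∑ i ∈ s, a i • y i = (X : F[X]) • z) →
      ∀ i ∈ s, a i = 0) : LinearIndependent F[X] y := by
  have hX : algebraMap F[X] K X ≠ 0 := by
    simp
  -- Independence modulo `X` kills the constant terms of a relation. Dividing by `X` and repeating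
  -- makes every coefficient divisible by all powers of `X`.
  have step (s : Finset ι) (c : ι → F[X]) (hc : ∑ i ∈ s, c i • y i = 0) :
      ∀ i ∈ s, (c i).coeff 0 = 0 := by
    refine h s _ ⟨-∑ i ∈ s, (c i).divX • y i,
      neg_mem (sum_mem fun i _ => N.smul_mem _ (hy i)), ?_⟩
    rw [smul_neg, eq_neg_iff_add_eq_zero, ← hc, Finset.smul_sum, ← Finset.sum_add_distrib]
    refine Finset.sum_congr rfl fun i _ => ?_
    conv_rhs => rw [← X_mul_divX_add (c i)]
    rw [add_smul, mul_smul, add_comm, ← algebraMap_eq, algebraMap_smul]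
  have key (n : ℕ) : ∀ (s : Finset ι) (c : ι → F[X]), ∑ i ∈ s, c i • y i = 0 →
      ∀ i ∈ s, X ^ n ∣ c i := by
    induction n with
    | zero => simp
    | succ n ih =>
      intro s c hc i hi
      have h0 := step s c hc
      have hdiv : ∀ i ∈ s, c i = X * (c i).divX := fun i hi => by
        conv_lhs => rw [← X_mul_divX_add (c i), h0 i hi, C_0, add_zero]
      have hc' : ∑ i ∈ s, (c i).divX • y i = 0 := by
        apply mul_left_cancel₀ hX
        rw [mul_zero, ← Algebra.smul_def, Finset.smul_sum, ← hc]
        refine Finset.sum_congr rfl fun i hi => ?_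
        rw [← mul_smul, ← hdiv i hi]
      rw [hdiv i hi, pow_succ']
      exact mul_dvd_mul_left X (ih s _ hc' i hi)
  rw [linearIndependent_iff']
  intro s c hc i hi
  ext n
  exact X_pow_dvd_iff.1 (key (n + 1) s c hc i hi) n (Nat.lt_succ_self n)

variable (F₀ : Type*) [Field F₀] [Algebra F[X] F₀] [IsFractionRing F[X] F₀] [Algebra F₀ K]
  [IsScalarTower F[X] F₀ K] [FiniteDimensional F₀ K]

/-- Lifts of an `F`-independent family in `N/XN` are independent over `F[X]`, hence over `F₀`. So
`N/XN` has dimension at most `[K : F₀]`, even if `N` is not finitely generated. -/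
theorem relIndex_map_mulXPow_one_le [Finite F] (N : Submodule F[X] K) :
    (N.toAddSubgroup.map (mulXPow F K 1)).relIndex N.toAddSubgroup ≠ 0 ∧
    (N.toAddSubgroup.map (mulXPow F K 1)).relIndex N.toAddSubgroup ≤
      Nat.card F ^ Module.finrank F₀ K := by
  let J : Submodule F N :=
    { (N.toAddSubgroup.map (mulXPow F K 1)).addSubgroupOf N.toAddSubgroup with
      smul_mem' := by
        rintro a ⟨x, hx⟩ ⟨z, hz, h⟩
        refine ⟨a • z, ?_, ?_⟩
        · rw [← algebraMap_smul F[X] a z]; exact N.smul_mem _ hz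
        · change mulXPow F K 1 z = x at h
          change mulXPow F K 1 (a • z) = ((a • (⟨x, hx⟩ : N) : N) : K)
          rw [mulXPow, AddMonoidHom.coe_mulLeft] at *
          rw [mul_smul_comm, h]; rfl }
  have hJ (x : N) : x ∈ J ↔ ∃ z ∈ N, (x : K) = (X : F[X]) • z := by
    constructor
    · rintro ⟨z, hz, h⟩
      refine ⟨z, hz, ?_⟩
      rw [Algebra.smul_def, ← pow_one (algebraMap F[X] K X)]
      exact h.symm
    · rintro ⟨z, hz, h⟩
      refine ⟨z, hz, ?_⟩
      rw [Algebra.smul_def, ← pow_one (algebraMap F[X] K X)] at h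
      exact h.symm
  have hrank : Module.rank F (N ⧸ J) ≤ (Module.finrank F₀ K : ℕ) := by
    refine rank_le fun s hs => ?_
    choose f hf using Submodule.mkQ_surjective J
    have hli : LinearIndependent F[X] fun i : s => (f i : K) := by
      refine linearIndependent_polynomial_of_forall_mem N _ (fun i => (f i).2) ?_
      rintro t a ⟨z, hz, h⟩ i hi
      refine linearIndependent_iff'.1 hs t a ?_ i hi
      have h1 : ∑ i ∈ t, a i • f i ∈ J := (hJ _).2 ⟨z, hz, by rw [← h]; simp⟩
      have h2 : J.mkQ (∑ i ∈ t, a i • f i) = 0 := (Submodule.Quotient.mk_eq_zero J).2 h1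
      rw [map_sum] at h2
      simpa only [map_smul, hf] using h2
    have hli' := (LinearIndependent.iff_fractionRing F[X] F₀).1 hli
    simpa using hli'.fintype_card_le_finrank
  have : Module.Finite F (N ⧸ J) :=
    Module.rank_lt_aleph0_iff.1 (hrank.trans_lt (Cardinal.natCast_lt_aleph0))
  have hcard : (N.toAddSubgroup.map (mulXPow F K 1)).relIndex N.toAddSubgroup =
      Nat.card (N ⧸ J) := rfl
  have : Finite (N ⧸ J) := Module.finite_of_finite F
  rw [hcard]
  refine ⟨Nat.card_pos.ne', ?_⟩
  rw [Module.natCard_eq_pow_finrank (K := F)]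
  exact Nat.pow_le_pow_right Nat.card_pos (Module.finrank_le_of_rank_le hrank)

theorem relIndex_map_mulXPow_le [Finite F] (N : Submodule F[X] K) (n : ℕ) :
    (N.toAddSubgroup.map (mulXPow F K n)).relIndex N.toAddSubgroup ≠ 0 ∧
    (N.toAddSubgroup.map (mulXPow F K n)).relIndex N.toAddSubgroup ≤
      (Nat.card F ^ Module.finrank F₀ K) ^ n := by
  induction n with
  | zero =>
    have h : N.toAddSubgroup.map (mulXPow F K 0) = N.toAddSubgroup := by
      ext x; simp [mulXPow]
    simp [h]
  | succ n ih =>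
    have h1 : N.toAddSubgroup.map (mulXPow F K (n + 1)) =
        (N.toAddSubgroup.map (mulXPow F K n)).map (mulXPow F K 1) := by
      rw [AddSubgroup.map_map]
      congr 1
      ext x
      simp [mulXPow, pow_succ', mul_assoc]
    have h2 := AddSubgroup.relIndex_mul_relIndex _ _ _
      (AddSubgroup.map_mono (f := mulXPow F K 1) (map_mulXPow_le N n)) (map_mulXPow_le N 1)
    rw [AddSubgroup.relIndex_map_map_of_injective (f := mulXPow F K 1) _ _
      (mulXPow_injective 1)] at h2
    have h3 := relIndex_map_mulXPow_one_le F₀ N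
    rw [h1, ← h2, pow_succ]
    exact ⟨mul_ne_zero ih.1 h3.1, Nat.mul_le_mul ih.2 h3.2⟩

end

/-! ### Constants, and the zeros of a function -/

theorem ValuationSubring.mem_of_isAlgebraic_of_finite {F K : Type*} [Field F] [Finite F] [Field K]
    [Algebra F K] (V : ValuationSubring K) {x : K} (hx : IsAlgebraic F x) : x ∈ V := by
  let : Algebra F V :=
    ((algebraMap F K).codRestrict V.toSubring V.algebraMap_mem_of_finite).toAlgebra
  have : IsScalarTower F V K := .of_algebraMap_eq fun _ => rfl
  exact V.mem_of_isIntegral hx.isIntegral.tower_top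

/-- Over a finite field, the elements with a pole or a zero at some valuation subring are
transcendental. -/
theorem transcendental_of_mem_nonunits {F K : Type*} [Field F] [Finite F] [Field K] [Algebra F K]
    (V : ValuationSubring K) {x : K} (hx0 : x ≠ 0) (hx : x ∈ V.nonunits) : Transcendental F x :=
  fun h => (V.mem_nonunits_iff_or.1 hx).elim hx0 (· (V.mem_of_isAlgebraic_of_finite h.inv))

section

variable {F K : Type*} [Field F] [Finite F] [Field K] [Algebra F K] [Algebra F[X] K]
  [IsScalarTower F F[X] K]

theorem ValuationSubring.algebraMap_polynomial_mem_of_finite (V : ValuationSubring K)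
    (hV : algebraMap F[X] K X ∈ V) (f : F[X]) : algebraMap F[X] K f ∈ V := by
  have h : algebraMap F[X] K f = aeval (algebraMap F[X] K X) f := by
    rw [aeval_algebraMap_apply, aeval_X_left_apply]
  rw [h]
  exact V.aeval_mem_of_finite hV f

/-- The intersection of a set of finite primes containing `X`, as an `F[X]`-module. -/
def FinitePrime.interSubmodule (D : Set (FinitePrime K))
    (hD : ∀ V ∈ D, algebraMap F[X] K X ∈ V.1) : Submodule F[X] K where
  carrier := {x | ∀ V ∈ D, x ∈ V.1}
  zero_mem' V _ := V.1.zero_mem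
  add_mem' hx hy V hV := V.1.add_mem _ _ (hx V hV) (hy V hV)
  smul_mem' f x hx V hV := by
    rw [Algebra.smul_def]
    exact V.1.mul_mem _ _ (V.1.algebraMap_polynomial_mem_of_finite (hD V hV) f) (hx V hV)

/-- For any finite set of zeros of `X`, weak approximation gives elements that are `1` at one zero
and `0` at the others. They are independent modulo `X`, so there are at most `[K : F₀]` zeros. -/
theorem FinitePrime.finite_setOf_mem_nonunits [FaithfulSMul F[X] K] (F₀ : Type*) [Field F₀]
    [Algebra F[X] F₀] [IsFractionRing F[X] F₀] [Algebra F₀ K] [IsScalarTower F[X] F₀ K]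
    [FiniteDimensional F₀ K] :
    {V : FinitePrime K | algebraMap F[X] K X ∈ V.1.nonunits}.Finite := by
  classical
  by_contra hinf
  obtain ⟨t, ht, hcard⟩ := Set.Infinite.exists_subset_card_eq hinf (Module.finrank F₀ K + 1)
  have he (V : t) : ∃ e, e - 1 ∈ V.1.1.nonunits ∧ ∀ W ∈ t.erase V, e ∈ W.1.nonunits :=
    V.1.exists_sub_one_mem_nonunits _ (Finset.notMem_erase _ _)
  choose e he1 he0 using he
  have hval (V W : t) : e V ∈ W.1.1 := by
    by_cases h : V = W
    · subst h
      simpa using V.1.1.add_mem _ _ (ValuationSubring.nonunits_subset (he1 V)) V.1.1.one_mem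
    · exact ValuationSubring.nonunits_subset (he0 V W
        (Finset.mem_erase.2 ⟨fun h' => h (Subtype.ext h'.symm), W.2⟩))
  have hli : LinearIndependent F[X] e := by
    refine linearIndependent_polynomial_of_forall_mem (FinitePrime.interSubmodule (t : Set _)
      fun V hV => ValuationSubring.nonunits_subset (ht hV)) _ (fun V W hW => hval V ⟨W, hW⟩) ?_
    rintro s a ⟨z, hz, h⟩ V hV
    by_contra ha
    have h1 : (X : F[X]) • z ∈ V.1.1.nonunits := by
      rw [Algebra.smul_def, ValuationSubring.mem_nonunits_iff, map_mul]
      exact mul_lt_one_of_lt_of_le (ht V.2) ((V.1.1.valuation_le_one_iff _).2 (hz V.1 V.2))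
    have h2 : ∑ i ∈ s.erase V, a i • e i ∈ V.1.1.nonunits := by
      refine sum_mem fun W hW => ?_
      rw [Algebra.smul_def, ValuationSubring.mem_nonunits_iff, map_mul, mul_comm]
      exact mul_lt_one_of_lt_of_le (he0 W V (Finset.mem_erase.2
        ⟨fun h' => (Finset.ne_of_mem_erase hW) (Subtype.ext h'.symm), V.2⟩))
        ((V.1.1.valuation_le_one_iff _).2 (V.1.1.algebraMap_mem_of_finite _))
    have h3 : e V ∈ V.1.1.nonunits := by
      have h4 : a V • e V ∈ V.1.1.nonunits := by
        rw [← h, ← Finset.add_sum_erase s _ hV] at h1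
        simpa using sub_mem h1 h2
      rw [← inv_smul_smul₀ ha (e V), Algebra.smul_def, ValuationSubring.mem_nonunits_iff, map_mul,
        mul_comm]
      exact mul_lt_one_of_lt_of_le h4
        ((V.1.1.valuation_le_one_iff _).2 (V.1.1.algebraMap_mem_of_finite _))
    have h5 : (1 : K) ∈ V.1.1.nonunits := by simpa using sub_mem h3 (he1 V)
    simp [ValuationSubring.mem_nonunits_iff] at h5
  have := ((LinearIndependent.iff_fractionRing F[X] F₀).1 hli).fintype_card_le_finrank
  simp [hcard] at this

end

/-! ### Riemann's inequality by counting -/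

theorem ValuationSubring.pow_mul_aeval_mem_of_finite {F K : Type*} [Field F] [Finite F]
    [Field K] [Algebra F K] (V : ValuationSubring K) {w y : K} (hw : w ∈ V) (hwy : w * y ∈ V)
    {n : ℕ} {f : F[X]} (hf : f.natDegree ≤ n) : w ^ n * aeval y f ∈ V := by
  rw [aeval_eq_sum_range, Finset.mul_sum]
  refine sum_mem fun i hi => ?_
  have hin : i ≤ n := (Nat.lt_succ_iff.1 (Finset.mem_range.1 hi)).trans hf
  rw [Algebra.smul_def, mul_left_comm, ← Nat.sub_add_cancel hin, pow_add, mul_assoc, ← mul_pow]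
  exact V.mul_mem _ _ (V.algebraMap_mem_of_finite _)
    (V.mul_mem _ _ (pow_mem hw _) (pow_mem hwy _))

/-- `y` is a root of `f - f(y)`, whose leading coefficient is a nonzero constant, so `y` is integral
over `V`. -/
theorem ValuationSubring.mem_of_aeval_mem_of_finite {F K : Type*} [Field F] [Finite F] [Field K]
    [Algebra F K] (V : ValuationSubring K) {y : K} {f : F[X]} (hf : f.natDegree ≠ 0)
    (hy : aeval y f ∈ V) : y ∈ V := by
  let : Algebra F V :=
    ((algebraMap F K).codRestrict V.toSubring V.algebraMap_mem_of_finite).toAlgebra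
  have : IsScalarTower F V K := .of_algebraMap_eq fun _ => rfl
  have hf0 : f ≠ 0 := by rintro rfl; simp at hf
  have hmonic : (f * C f.leadingCoeff⁻¹).Monic := monic_mul_leadingCoeff_inv hf0
  refine V.mem_of_isIntegral (IsIntegral.of_aeval_monic (hmonic.map (algebraMap F V)) ?_ ?_)
  · rwa [hmonic.natDegree_map, natDegree_mul_leadingCoeff_inv f hf0]
  · rw [aeval_map_algebraMap, map_mul, aeval_C]
    exact isIntegral_algebraMap
      (x := (⟨_, V.mul_mem _ _ hy (V.algebraMap_mem_of_finite _)⟩ : V))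

theorem Polynomial.natDegree_le_of_mem_degreeLT {F : Type*} [Semiring F] {n : ℕ} {f : F[X]}
    (hf : f ∈ degreeLT F (n + 1)) : f.natDegree ≤ n := by
  rcases eq_or_ne f 0 with rfl | h0
  · simp
  · exact Nat.lt_succ_iff.1 ((natDegree_lt_iff_degree_lt h0).2 (mem_degreeLT.1 hf))

theorem Polynomial.natCard_degreeLT (F : Type*) [Semiring F] (n : ℕ) :
    Nat.card (degreeLT F n) = Nat.card F ^ n := by
  rw [Nat.card_congr (degreeLTEquiv F n).toEquiv, Nat.card_fun, Nat.card_fin]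

section

variable {F K : Type*} [Field F] [Finite F] [Field K] [Algebra F K] [Algebra F[X] K]
  [IsScalarTower F F[X] K] (F₀ : Type*) [Field F₀] [Algebra F[X] F₀]
  [IsFractionRing F[X] F₀] [Algebra F₀ K] [IsScalarTower F[X] F₀ K] [FiniteDimensional F₀ K]

/-- A basis of a function field consisting of elements regular at all finite primes containing
`X⁻¹`. -/
theorem exists_linearIndependent_forall_mem
    [FiniteDimensional F⟮(algebraMap F[X] K X)⁻¹⟯ K] :
    ∃ ω : Fin (Module.finrank F₀ K) → K, LinearIndependent F[X] ω ∧
      ∀ j (V : ValuationSubring K), (algebraMap F[X] K X)⁻¹ ∈ V → ω j ∈ V := by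
  set t := (algebraMap F[X] K X)⁻¹ with ht
  let b := Module.finBasis F₀ K
  -- A multiplier from `F[t]` makes `x` integral over `F[t]`. It lies in `F₀`, so rescaling a basis
  -- by such multipliers preserves independence.
  have hmul (x : K) : ∃ c : F₀, c ≠ 0 ∧
      ∀ V : ValuationSubring K, t ∈ V → algebraMap F₀ K c * x ∈ V := by
    have hx : IsAlgebraic (Algebra.adjoin F {t}) x :=
      isAlgebraic_adjoin_iff.1 (Algebra.IsAlgebraic.isAlgebraic x)
    obtain ⟨h, hh0, hh⟩ := hx.exists_integral_multiple
    have hrange : Algebra.adjoin F {t} ≤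
        { (algebraMap F₀ K).fieldRange with
          algebraMap_mem' := fun a => ⟨algebraMap F[X] F₀ (C a), by
            rw [← IsScalarTower.algebraMap_apply F[X] F₀ K, ← algebraMap_eq,
              ← IsScalarTower.algebraMap_apply F F[X] K]⟩ } := by
      rw [Algebra.adjoin_le_iff, Set.singleton_subset_iff]
      exact ⟨(algebraMap F[X] F₀ X)⁻¹, by
        rw [map_inv₀, ← IsScalarTower.algebraMap_apply F[X] F₀ K]⟩
    obtain ⟨c, hc⟩ := hrange h.2
    refine ⟨c, ?_, fun V hV => ?_⟩
    · rintro rfl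
      exact hh0 (Subtype.ext (by rw [← hc, map_zero]; rfl))
    · have hle : ∀ y ∈ Algebra.adjoin F {t}, y ∈ V := by
        intro y hy
        rw [Algebra.adjoin_singleton_eq_range_aeval] at hy
        obtain ⟨f, rfl⟩ := hy
        exact V.aeval_mem_of_finite hV f
      let : Algebra (Algebra.adjoin F {t}) V :=
        (Subring.inclusion (S := (Algebra.adjoin F {t}).toSubring) (T := V.toSubring) hle).toAlgebra
      have : IsScalarTower (Algebra.adjoin F {t}) V K := .of_algebraMap_eq fun _ => rfl
      rw [hc]
      exact V.mem_of_isIntegral hh.tower_top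
  choose c hc0 hc using hmul
  refine ⟨fun j => algebraMap F₀ K (c (b j)) * b j, ?_, fun j => hc (b j)⟩
  rw [LinearIndependent.iff_fractionRing F[X] F₀]
  have heq : (fun j => algebraMap F₀ K (c (b j)) * b j) =
      (fun j => Units.mk0 _ (hc0 (b j))) • ⇑b := by
    ext j
    simp [Algebra.smul_def, Units.smul_def]
  rw [heq]
  exact b.linearIndependent.units_smul _

end

/-- A weak form of Riemann's inequality: for every finite prime there is a nonconstant function
without poles at the other finite primes. -/
theorem FinitePrime.exists_transcendental_forall_mem_of_mem_nonunits {F K : Type*} [Field F]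
    [Finite F] [Field K] [Algebra F K] [Algebra F[X] K] [IsScalarTower F F[X] K]
    [FaithfulSMul F[X] K] (F₀ : Type*) [Field F₀] [Algebra F[X] F₀] [IsFractionRing F[X] F₀]
    [Algebra F₀ K] [IsScalarTower F[X] F₀ K] [FiniteDimensional F₀ K]
    [FiniteDimensional F⟮(algebraMap F[X] K X)⁻¹⟯ K] (V₀ : FinitePrime K)
    (hV₀ : algebraMap F[X] K X ∈ V₀.1.nonunits) :
    ∃ b : K, Transcendental F b ∧ ∀ V : FinitePrime K, V ≠ V₀ → b ∈ V.1 := by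
  classical
  set s := algebraMap F[X] K X with hs
  have hs0 : s ≠ 0 := by simp [s]
  set n := Module.finrank F₀ K with hn
  have hn0 : 0 < n := Module.finrank_pos
  have hq : 1 < Nat.card F := Finite.one_lt_card
  set q := Nat.card F
  have hD := FinitePrime.finite_setOf_mem_nonunits (F := F) (K := K) F₀
  set D := {V : FinitePrime K | s ∈ V.1.nonunits}
  have hDs : ∀ V ∈ D, s ∈ V.1 := fun V hV => ValuationSubring.nonunits_subset hV
  let O := interSubmodule (F := F) D hDs
  let O' := interSubmodule (F := F) (D \ {V₀}) fun V hV => hDs V hV.1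
  -- an element with a pole at `V₀` only, among the zeros of `X`
  obtain ⟨y, hy0, hy⟩ := V₀.exists_notMem_forall_mem_nonunits (hD.toFinset.erase V₀)
    (Finset.notMem_erase _ _)
  replace hy (V : FinitePrime K) (hV : V ∈ D) (hne : V ≠ V₀) : y ∈ V.1 :=
    ValuationSubring.nonunits_subset
      (hy V (Finset.mem_erase.2 ⟨hne, hD.mem_toFinset.2 hV⟩))
  obtain ⟨c, hc⟩ : ∃ c : ℕ, s ^ (c + 1) * y ∈ V₀.1 := by
    obtain ⟨c, hc⟩ := V₀.exists_forall_pow_mul_mem_nonunits hV₀ y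
    exact ⟨c, ValuationSubring.nonunits_subset (hc _ c.le_succ)⟩
  obtain ⟨ω, hω, hωV⟩ := exists_linearIndependent_forall_mem (F := F) (K := K) F₀
  obtain ⟨C₁, hC₁⟩ : ∃ C₁ : ℕ, ∀ j, s ^ C₁ * ω j ∈ O := by
    have h (V : FinitePrime K) (j) : ∃ N : ℕ, V ∈ D → ∀ m ≥ N, s ^ m * ω j ∈ V.1.nonunits := by
      by_cases hV : V ∈ D
      · obtain ⟨N, hN⟩ := V.exists_forall_pow_mul_mem_nonunits hV (ω j)
        exact ⟨N, fun _ => hN⟩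
      · exact ⟨0, fun h => (hV h).elim⟩
    choose N hN using h
    refine ⟨hD.toFinset.sup fun V => Finset.univ.sup (N V), fun j V hV =>
      ValuationSubring.nonunits_subset (hN V j hV _ ?_)⟩
    exact (Finset.le_sup (f := N V) (Finset.mem_univ j)).trans
      (Finset.le_sup (f := fun V => Finset.univ.sup (N V)) (hD.mem_toFinset.2 hV))
  -- With `T = N + C₁`, the count below gives `|H| ≥ q ^ (n (N + 1) + M - n T) = q ^ (n - n C₁ +
  -- M)`. This choice of `M` makes it `q ^ (n + 1)`.
  set M := n * C₁ + 1 with hM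
  obtain ⟨N, hN⟩ : ∃ N, (c + 1) * M = N + C₁ := by
    refine ⟨(c + 1) * M - C₁, (Nat.sub_add_cancel ?_).symm⟩
    nlinarith [Nat.zero_le (c * M), Nat.le_mul_of_pos_left C₁ hn0]
  set T := (c + 1) * M with hT
  let Y : AddSubgroup K := O.toAddSubgroup.map (mulXPow F K T)
  let Z : AddSubgroup K := O.toAddSubgroup ⊓ O'.toAddSubgroup.map (mulXPow F K T)
  have hYZ : Y ≤ Z := by
    refine le_inf (map_mulXPow_le O T) (AddSubgroup.map_mono fun x hx V hV => hx V hV.1)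
  have hYO := relIndex_map_mulXPow_le F₀ O T
  have hmul := AddSubgroup.relIndex_mul_relIndex Y Z O.toAddSubgroup hYZ inf_le_left
  have hYZ0 : Y.relIndex Z ≠ 0 := left_ne_zero_of_mul (hmul ▸ hYO.1)
  have hZO0 : Z.relIndex O.toAddSubgroup ≠ 0 := right_ne_zero_of_mul (hmul ▸ hYO.1)
  -- polynomials in `y` bound the index of `Y` in `Z` from below
  have hYZcard : q ^ M ≤ Y.relIndex Z := by
    -- The factor `X` excludes constants, so every nonzero polynomial value here has a pole at `V₀`.
    let g : degreeLT F M →+ K :=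
      { toFun := fun f => s ^ T * aeval y (X * (f : F[X]))
        map_zero' := by simp
        map_add' := fun f f' => by simp [mul_add] }
    have hdeg (f : degreeLT F M) (h : aeval y (X * (f : F[X])) ∈ V₀.1) : f = 0 := by
      by_contra hf
      have hf' : (f : F[X]) ≠ 0 := fun h => hf (Subtype.ext h)
      exact hy0 (V₀.1.mem_of_aeval_mem_of_finite
        (by rw [natDegree_X_mul hf']; exact Nat.succ_ne_zero _) h)
    have hinj : Function.Injective g := by
      rw [injective_iff_map_eq_zero]
      intro f hf
      refine hdeg f ?_
      rw [(mul_eq_zero.1 (show s ^ T * _ = 0 from hf)).resolve_left (pow_ne_zero _ hs0)]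
      exact V₀.1.zero_mem
    have hgZ : g.range ≤ Z := by
      rintro _ ⟨f, rfl⟩
      have hf : (X * (f : F[X])).natDegree ≤ M := by
        refine natDegree_mul_le.trans ?_
        rw [natDegree_X, add_comm]
        exact Nat.succ_le_succ (natDegree_le_of_mem_degreeLT f.2)
      have hfV (V : FinitePrime K) (hV : V ∈ D) (hne : V ≠ V₀) :
          aeval y (X * (f : F[X])) ∈ V.1 := V.1.aeval_mem_of_finite (hy V hV hne) _
      refine ⟨fun V hV => ?_, ⟨_, fun V hV => hfV V hV.1 hV.2, rfl⟩⟩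
      by_cases hne : V = V₀
      · subst hne
        change s ^ T * _ ∈ V.1
        rw [hT, pow_mul]
        exact V.1.pow_mul_aeval_mem_of_finite (pow_mem (hDs V hV) _) hc hf
      · exact V.1.mul_mem _ _ (pow_mem (hDs V hV) _) (hfV V hV hne)
    have hYg : Y ⊓ g.range = ⊥ := by
      rw [eq_bot_iff]
      rintro _ ⟨⟨o, ho, hog⟩, f, rfl⟩
      have h1 : aeval y (X * (f : F[X])) = o :=
        mul_left_cancel₀ (pow_ne_zero T hs0) (show s ^ T * _ = s ^ T * o from hog.symm)
      have h2 := hdeg f (h1 ▸ ho V₀ hV₀)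
      rw [h2, map_zero]; exact AddSubgroup.zero_mem _
    calc q ^ M = Nat.card g.range := by
          rw [← natCard_degreeLT]; exact Nat.card_congr (AddMonoidHom.ofInjective hinj).toEquiv
      _ = Y.relIndex g.range := by
          rw [← AddSubgroup.inf_relIndex_right, hYg, AddSubgroup.relIndex_bot_left]
      _ ≤ Y.relIndex Z := AddSubgroup.relIndex_le_of_le_right hgZ hYZ0
  -- many elements of `O`, whose quotients by `X ^ T` are regular outside the zeros of `X`
  let g : (Fin n → degreeLT F (N + 1)) →+ K :=
    { toFun := fun f => s ^ C₁ * ∑ j, (f j : F[X]) • ω j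
      map_zero' := by simp
      map_add' := fun f f' => by simp [add_smul, Finset.sum_add_distrib, mul_add] }
  have hginj : Function.Injective g := by
    rw [injective_iff_map_eq_zero]
    intro f hf
    have h1 := (mul_eq_zero.1 (show s ^ C₁ * _ = 0 from hf)).resolve_left (pow_ne_zero _ hs0)
    funext j
    exact Subtype.ext (Fintype.linearIndependent_iff.1 hω (fun j => (f j : F[X])) h1 j)
  have hgO : g.range ≤ O.toAddSubgroup := by
    rintro _ ⟨f, rfl⟩
    change s ^ C₁ * _ ∈ O
    rw [Finset.mul_sum]
    exact sum_mem fun j _ => by rw [mul_smul_comm]; exact O.smul_mem _ (hC₁ j)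
  have hgcard : Nat.card g.range = (q ^ (N + 1)) ^ n := by
    rw [← Nat.card_congr (AddMonoidHom.ofInjective hginj).toEquiv, Nat.card_fun, Nat.card_fin,
      natCard_degreeLT]
  let H := Z ⊓ g.range
  have hHcard : q ^ n < Nat.card H := by
    have h1 := AddSubgroup.relIndex_mul_relIndex ⊥ H g.range bot_le inf_le_right
    rw [AddSubgroup.relIndex_bot_left, AddSubgroup.relIndex_bot_left, hgcard,
      AddSubgroup.inf_relIndex_right] at h1
    have h2 : Z.relIndex g.range ≤ Z.relIndex O.toAddSubgroup :=
      AddSubgroup.relIndex_le_of_le_right hgO hZO0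
    by_contra! hle
    have h3 : (q ^ (N + 1)) ^ n * q ^ M ≤ q ^ n * (q ^ n) ^ T := by
      calc (q ^ (N + 1)) ^ n * q ^ M
          ≤ (Nat.card H * Z.relIndex O.toAddSubgroup) * Y.relIndex Z := by
            rw [← h1]; gcongr
        _ = Nat.card H * Y.relIndex O.toAddSubgroup := by rw [← hmul]; ring
        _ ≤ q ^ n * (q ^ n) ^ T := Nat.mul_le_mul hle hYO.2
    rw [← pow_mul, ← pow_mul, ← pow_add, ← pow_add] at h3
    have h4 := (Nat.pow_le_pow_iff_right hq).1 h3
    rw [hN] at h4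
    nlinarith
  have hHreg (u : K) (hu : u ∈ H) (V : FinitePrime K) (hV : V ≠ V₀) : (s ^ T)⁻¹ * u ∈ V.1 := by
    by_cases hVD : V ∈ D
    · obtain ⟨o, ho, rfl⟩ := hu.1.2
      change (s ^ T)⁻¹ * (s ^ T * o) ∈ V.1
      rw [inv_mul_cancel_left₀ (pow_ne_zero T hs0)]
      exact ho V ⟨hVD, hV⟩
    · obtain ⟨f, rfl⟩ := hu.2
      have hsV : s⁻¹ ∈ V.1 := by
        by_contra h
        exact hVD (V.1.mem_nonunits_iff_or.2 (Or.inr h))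
      change (s ^ T)⁻¹ * (s ^ C₁ * ∑ j, (f j : F[X]) • ω j) ∈ V.1
      rw [hN, pow_add, mul_inv, mul_assoc, inv_mul_cancel_left₀ (pow_ne_zero C₁ hs0),
        Finset.mul_sum]
      refine sum_mem fun j _ => ?_
      rw [Algebra.smul_def, ← mul_assoc, ← inv_pow]
      have h : algebraMap F[X] K (f j) = aeval s (f j : F[X]) := by
        rw [aeval_algebraMap_apply, aeval_X_left_apply]
      rw [h]
      exact V.1.mul_mem _ _ (V.1.pow_mul_aeval_mem_of_finite hsV
        (by rw [inv_mul_cancel₀ hs0]; exact V.1.one_mem) (natDegree_le_of_mem_degreeLT (f j).2))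
        (hωV j V.1 hsV)
  -- Either some `u / s ^ T` has a pole at `V₀`, or `H` lies in `s ^ T O`. In the second case, `|H|
  -- > q ^ n ≥ [O : sO]` forces a nonzero `u / s ^ T` to vanish at `V₀`. A pole or a zero makes it
  -- transcendental.
  by_cases hH : ∃ u ∈ H, (s ^ T)⁻¹ * u ∉ V₀.1
  · obtain ⟨u, hu, hu0⟩ := hH
    exact ⟨_, fun h => hu0 (V₀.1.mem_of_isAlgebraic_of_finite h), hHreg u hu⟩
  · push Not at hH
    have hHY : H ≤ Y := by
      intro u hu
      refine ⟨(s ^ T)⁻¹ * u, fun V hV => ?_, mul_inv_cancel_left₀ (pow_ne_zero T hs0) u⟩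
      by_cases hne : V = V₀
      · exact hne ▸ hH u hu
      · exact hHreg u hu V hne
    have h1 := relIndex_map_mulXPow_one_le F₀ O
    have h2 := AddSubgroup.relIndex_map_map_of_injective (f := mulXPow F K T)
      (O.toAddSubgroup.map (mulXPow F K 1)) O.toAddSubgroup (mulXPow_injective T)
    obtain ⟨u, hu, huH, hu0⟩ : ∃ u ∈ (O.toAddSubgroup.map (mulXPow F K 1)).map (mulXPow F K T),
        u ∈ H ∧ u ≠ 0 := by
      by_contra! hall
      have h3 : (O.toAddSubgroup.map (mulXPow F K 1)).map (mulXPow F K T) ⊓ H = ⊥ := by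
        rw [eq_bot_iff]
        exact fun u hu => hall u hu.1 hu.2
      have h4 := AddSubgroup.relIndex_le_of_le_right hHY (h2 ▸ h1.1)
      rw [← AddSubgroup.inf_relIndex_right, h3, AddSubgroup.relIndex_bot_left, h2] at h4
      exact absurd (h4.trans h1.2) (not_le.2 hHcard)
    refine ⟨(s ^ T)⁻¹ * u, transcendental_of_mem_nonunits V₀.1
      (mul_ne_zero (inv_ne_zero (pow_ne_zero T hs0)) hu0) ?_, hHreg u huH⟩
    obtain ⟨_, ⟨o, ho, rfl⟩, rfl⟩ := hu
    change (s ^ T)⁻¹ * (s ^ T * (s ^ 1 * o)) ∈ V₀.1.nonunits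
    rw [inv_mul_cancel_left₀ (pow_ne_zero T hs0), pow_one, ValuationSubring.mem_nonunits_iff,
      map_mul]
    exact mul_lt_one_of_lt_of_le hV₀ ((V₀.1.valuation_le_one_iff _).2 (ho V₀ hV₀))

theorem FinitePrime.exists_transcendental_forall_mem {K : Type*} [Field K]
    (hK : IsGlobalFunctionField K) (V₀ : FinitePrime K) :
    ∃ b : K, Transcendental (constantField K) b ∧ ∀ V : FinitePrime K, V ≠ V₀ → b ∈ V.1 := by
  obtain ⟨F, _, hF, _, hfin⟩ := hK.exists_finite_field
  obtain ⟨s, hs0, hs⟩ := V₀.exists_ne_zero_mem_nonunits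
  have hst : Transcendental F s := transcendental_of_mem_nonunits V₀.1 hs0 hs
  have := hfin s hst
  obtain ⟨_, _, _, _, _, hX⟩ := exists_algebra_ratFunc_of_transcendental hst
  have hX' : algebraMap F[X] K X = s := by rw [hX, aeval_X]
  have : FiniteDimensional F⟮(algebraMap F[X] K X)⁻¹⟯ K := by
    rw [hX']
    exact hfin _ fun h => hst (inv_inv s ▸ h.inv)
  have : FaithfulSMul F[X] K := .trans F[X] (RatFunc F) K
  obtain ⟨b, hb, h⟩ := FinitePrime.exists_transcendental_forall_mem_of_mem_nonunits (F := F)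
    (RatFunc F) V₀ (hX' ▸ hs)
  exact ⟨b, fun h => hb (isAlgebraic_constantField_iff.1 h), h⟩

theorem corollary1p3 (K : Type*) [Field K] (hK : IsGlobalField K)
    (S : Finset (FinitePrime K)) (hS : IsGlobalFunctionField K → S.Nonempty)
    (k m : ℕ) (hk : 0 < k) (hm : 0 < m) :
    (∃ r : Fin m → SIntegerRing S, IsPermutationChainInfinitelyOften k r) ∧
    (NumberField K → ∀ (P : Ideal (SIntegerRing S)) (p : ℕ), P.IsPrime → p.Prime →
      (p : SIntegerRing S) ∈ P →
      IsPermutationChainInfinitelyOften k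
        (fun i : Fin m => (p : SIntegerRing S) ^ (i : ℕ))) ∧
    (IsGlobalFunctionField K → ∀ t : SIntegerRing S,
      Transcendental (constantField K) (t : K) →
      IsPermutationChainInfinitelyOften k (fun i : Fin m => t ^ (i : ℕ))) := by
  refine ⟨?_, fun _ _ _ _ hp _ => isPermutationChainInfinitelyOften_natCast_pow S hk m hp.two_le,
    fun hK' t ht => isPermutationChainInfinitelyOften_pow_of_transcendental hK' S hk m t ht⟩
  rcases hK with hK | hK
  -- Here the sequence is the powers of `2`.
  · exact ⟨_, isPermutationChainInfinitelyOften_natCast_pow S hk m le_rfl⟩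
  -- Poles are allowed at `V₀ ∈ S`, so `b` is an `S`-integer.
  · obtain ⟨V₀, hV₀⟩ := hS hK
    obtain ⟨b, hb, hbV⟩ := V₀.exists_transcendental_forall_mem hK
    exact ⟨_, isPermutationChainInfinitelyOften_pow_of_transcendental hK S hk m
      ⟨b, fun V hV => hbV V fun h => hV (h ▸ hV₀)⟩ hb⟩
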